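/- Let $N\ge 3$, let $\Omega\subset\mathbb{R}^N$ be a bounded smooth domain, let $a$ be a positive measurable function on $\Omega$, and let $\gamma>0$ and $3\le p<\infty$. Let $g:\mathbb{R}\to\mathbb{R}$ be the odd function determined by $g(0)=0$ and $g'(t)=(1+2g(t)^2)^{-1/2}$ for $t\ge 0$. For $\lambda\ge 0$ consider the problems $$(Q_\lambda)\quad -\Delta v=\big[a(x)g(v)^{-\gamma}+\lambda g(v)^p\big]g'(v)\ \text{ in }\Omega,\qquad v>0\ \text{ in }\Omega,\qquad v=0\ \text{ on }\partial\Omega,$$ $$(P_\lambda)\quad -\Delta u-\Delta(u^2)u=a(x)u^{-\gamma}+\lambda u^p\ \text{ in }\Omega,\qquad u>0\ \text{ in }\Omega,\qquad u=0\ \text{ on }\partial\Omega.$$ A solution of $(Q_\lambda)$ is a function $v\in H_0^1(\Omega)\cap L^\infty(\Omega)$ with $v>0$ a.e. in $\Omega$ such that, for every $\psi\in H_0^1(\Omega)$, the functions $a\,g(v)^{-\gamma}g'(v)\psi$ and $g(v)^pg'(v)\psi$ are in $L^1(\Omega)$ and $$\int_\Omega\nabla v\cdot\nabla\psi=\int_\Omega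 a\,g(v)^{-\gamma}g'(v)\psi+\lambda\int_\Omega g(v)^pg'(v)\psi .$$ A solution of $(P_\lambda)$ is a function $u\in H_0^1(\Omega)\cap L^\infty(\Omega)$ with $u>0$ a.e. in $\Omega$ such that, for every $\psi\in H_0^1(\Omega)$, the functions $u|\nabla u|^2\psi$, $a\,u^{-\gamma}\psi$ and $u^p\psi$ are in $L^1(\Omega)$ and $$\int_\Omega\big[(1+2u^2)\nabla u\cdot\nabla\psi+2u|\nabla u|^2\psi\big]=\int_\Omega a\,u^{-\gamma}\psi+\lambda\int_\Omega u^p\psi .$$ Then there exists a constant $\lambda^*>0$ such that, for every $\lambda>\lambda^*$, neither $(Q_\lambda)$ nor $(P_\lambda)$ has a solution. -/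

import Mathlib

open MeasureTheory Filter Topology Set
open scoped ContDiff ENNReal

namespace QuasilinearSingular

/-! ### Bounded smooth domains -/

/-- A bounded smooth domain: a nonempty bounded connected open set which, near each of its
boundary points, is the sublevel set `{ρ < 0}` of a smooth function `ρ` with nonvanishing
differential at that point. -/
structure IsBoundedSmoothDomain {N : ℕ} (Ω : Set (EuclideanSpace ℝ (Fin N))) : Prop where
  isOpen : IsOpen Ω
  isConnected : IsConnected Ω
  isBounded : Bornology.IsBounded Ω
  smooth_boundary : ∀ x ∈ frontier Ω, ∃ (U : Set (EuclideanSpace ℝ (Fin N)))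
    (ρ : EuclideanSpace ℝ (Fin N) → ℝ), IsOpen U ∧ x ∈ U ∧ ContDiffOn ℝ ∞ ρ U ∧
      fderiv ℝ ρ x ≠ 0 ∧ Ω ∩ U = {y ∈ U | ρ y < 0}

/-! ### The Sobolev space `H₀¹(Ω)` -/

/-- `φ ∈ C_c^∞(Ω)` (extended by zero to the whole space). -/
structure IsTestFunction {N : ℕ} (Ω : Set (EuclideanSpace ℝ (Fin N)))
    (φ : EuclideanSpace ℝ (Fin N) → ℝ) : Prop where
  contDiff : ContDiff ℝ ∞ φ
  hasCompactSupport : HasCompactSupport φ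
  tsupport_subset : tsupport φ ⊆ Ω

/-- `G` is the weak (distributional) gradient of `v` on `Ω`. -/
structure HasWeakGradient {N : ℕ} (Ω : Set (EuclideanSpace ℝ (Fin N)))
    (v : EuclideanSpace ℝ (Fin N) → ℝ)
    (G : EuclideanSpace ℝ (Fin N) → EuclideanSpace ℝ (Fin N)) : Prop where
  locallyIntegrableOn : LocallyIntegrableOn v Ω
  locallyIntegrableOn_gradient : LocallyIntegrableOn G Ω
  integral_eq : ∀ φ : EuclideanSpace ℝ (Fin N) → ℝ, IsTestFunction Ω φ →
    ∀ w : EuclideanSpace ℝ (Fin N),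
      ∫ x in Ω, v x * fderiv ℝ φ x w = - ∫ x in Ω, inner ℝ (G x) w * φ x

/-- `v ∈ H₀¹(Ω)` with weak gradient `G`: `v` and `G` are in `L²(Ω)`, `G` is the weak gradient
of `v`, and `v` is in the closure of `C_c^∞(Ω)` for the `H¹`-norm. (The weak gradient is
unique up to almost everywhere equality on `Ω`.) -/
structure HasH10Gradient {N : ℕ} (Ω : Set (EuclideanSpace ℝ (Fin N)))
    (v : EuclideanSpace ℝ (Fin N) → ℝ)
    (G : EuclideanSpace ℝ (Fin N) → EuclideanSpace ℝ (Fin N)) : Prop where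
  memLp : MemLp v 2 (volume.restrict Ω)
  memLp_gradient : MemLp G 2 (volume.restrict Ω)
  hasWeakGradient : HasWeakGradient Ω v G
  exists_approx : ∃ φ : ℕ → EuclideanSpace ℝ (Fin N) → ℝ,
    (∀ n, IsTestFunction Ω (φ n)) ∧
    Tendsto (fun n => eLpNorm (fun x => φ n x - v x) 2 (volume.restrict Ω)) atTop (𝓝 0) ∧
    Tendsto (fun n => eLpNorm (fun x => gradient (φ n) x - G x) 2 (volume.restrict Ω))
      atTop (𝓝 0)

/-! ### The change of variables `g` -/

/-- The inverse of the change of variables, `s ↦ ∫₀ˢ (1 + 2 r²)^{1/2} dr`. -/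
noncomputable def gInv (s : ℝ) : ℝ := ∫ r in (0 : ℝ)..s, √(1 + 2 * r ^ 2)

/-- The change of variables `g`: the odd function with `g' = (1 + 2 g²)^{-1/2}` on `[0, ∞)`,
obtained as the inverse of the bijection `gInv`; see `g_spec` and `g_unique`. -/
noncomputable def g : ℝ → ℝ := Function.invFun gInv

theorem hasDerivAt_gInv (s : ℝ) : HasDerivAt gInv (√(1 + 2 * s ^ 2)) s :=
  (Continuous.integral_hasStrictDerivAt (f := fun r : ℝ => √(1 + 2 * r ^ 2))
    (by fun_prop) 0 s).hasDerivAt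

theorem strictMono_gInv : StrictMono gInv := by
  apply strictMono_of_deriv_pos
  intro s
  rw [(hasDerivAt_gInv s).deriv]
  positivity

theorem gInv_zero : gInv 0 = 0 := by simp [gInv]

theorem gInv_neg (s : ℝ) : gInv (-s) = -gInv s := by
  have h := intervalIntegral.integral_comp_neg (a := 0) (b := s)
    (fun r : ℝ => √(1 + 2 * r ^ 2))
  simp only [neg_zero, even_two, Even.neg_pow] at h
  rw [gInv, gInv, h, intervalIntegral.integral_symm]

theorem le_gInv {s : ℝ} (hs : 0 ≤ s) : s ≤ gInv s := by
  have h : ∫ _ in (0 : ℝ)..s, (1 : ℝ) ≤ gInv s := by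
    apply intervalIntegral.integral_mono_on hs
    · exact intervalIntegrable_const
    · exact Continuous.intervalIntegrable (by fun_prop) _ _
    · intro r _
      rw [Real.one_le_sqrt]
      nlinarith [sq_nonneg r]
  simpa using h

theorem surjective_gInv : Function.Surjective gInv := by
  have hc : Continuous gInv :=
    continuous_iff_continuousAt.2 fun s => (hasDerivAt_gInv s).continuousAt
  have htop : Tendsto gInv atTop atTop :=
    tendsto_atTop_mono' _ ((eventually_ge_atTop 0).mono fun s hs => le_gInv hs) tendsto_id
  refine hc.surjective htop ?_
  have h2 : gInv = fun s => -gInv (-s) := by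
    funext s
    rw [gInv_neg, neg_neg]
  rw [h2]
  exact tendsto_neg_atTop_atBot.comp (htop.comp tendsto_neg_atBot_atTop)

theorem gInv_g (t : ℝ) : gInv (g t) = t :=
  Function.rightInverse_invFun surjective_gInv t

theorem g_gInv (s : ℝ) : g (gInv s) = s :=
  Function.leftInverse_invFun strictMono_gInv.injective s

theorem hasDerivAt_g (t : ℝ) : HasDerivAt g (1 / √(1 + 2 * |g t| ^ 2)) t := by
  have hm : StrictMono g := by
    intro x y hxy
    rw [← strictMono_gInv.lt_iff_lt, gInv_g, gInv_g]
    exact hxy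
  have hc : Continuous g :=
    hm.monotone.continuous_of_surjective fun s => ⟨gInv s, g_gInv s⟩
  rw [sq_abs, one_div]
  exact (hasDerivAt_gInv (g t)).of_local_left_inverse hc.continuousAt (by positivity)
    (Eventually.of_forall gInv_g)

theorem g_odd (t : ℝ) : g t = -g (-t) := by
  apply strictMono_gInv.injective
  rw [gInv_neg, gInv_g, gInv_g, neg_neg]

/-- The problem that determines the change of variables. -/
def IsChangeOfVariables (f : ℝ → ℝ) : Prop :=
  (∀ t ∈ Ici (0 : ℝ), HasDerivWithinAt f (1 / √(1 + 2 * |f t| ^ 2)) (Ici 0) t) ∧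
    ∀ t ∈ Iic (0 : ℝ), f t = -f (-t)

theorem g_spec : IsChangeOfVariables g :=
  ⟨fun t _ => (hasDerivAt_g t).hasDerivWithinAt, fun t _ => g_odd t⟩

theorem g_unique {f : ℝ → ℝ} (hf : IsChangeOfVariables f) : f = g := by
  have h0 : f 0 = 0 := by
    have := hf.2 0 (by simp)
    rw [neg_zero] at this
    linarith
  have hd : ∀ t ∈ Ici (0 : ℝ),
      HasDerivWithinAt (fun t => gInv (f t) - t) 0 (Ici 0) t := by
    intro t ht
    have h := ((hasDerivAt_gInv (f t)).comp_hasDerivWithinAt t (hf.1 t ht)).sub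
      (hasDerivWithinAt_id t _)
    have hpos : √(1 + 2 * f t ^ 2) ≠ 0 := by positivity
    rw [sq_abs, mul_one_div_cancel hpos, sub_self] at h
    exact h
  have hpos : ∀ t, 0 ≤ t → f t = g t := by
    intro t ht
    have h := constant_of_has_deriv_right_zero (a := 0) (b := t)
      (f := fun t => gInv (f t) - t)
      (fun x hx => ((hd x hx.1).continuousWithinAt).mono Icc_subset_Ici_self)
      (fun x hx => (hd x hx.1).mono (Ici_subset_Ici.2 hx.1)) t ⟨ht, le_rfl⟩
    simp only [h0, gInv_zero, sub_self] at h
    rw [← g_gInv (f t), sub_eq_zero.1 h]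
  funext t
  rcases le_total 0 t with ht | ht
  · exact hpos t ht
  · rw [hf.2 t ht, g_odd t, hpos (-t) (by linarith)]

/-! ### Weak solutions -/

/-- `v` is a (positive, bounded, weak) solution of
`-Δv = [a(x) g(v)^{-γ} + lam g(v)^p] g'(v)` in `Ω`, `v > 0` in `Ω`, `v = 0` on `∂Ω`. -/
def IsSolutionQ {N : ℕ} (Ω : Set (EuclideanSpace ℝ (Fin N)))
    (a : EuclideanSpace ℝ (Fin N) → ℝ) (γ p lam : ℝ)
    (v : EuclideanSpace ℝ (Fin N) → ℝ) : Prop :=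
  MemLp v ∞ (volume.restrict Ω) ∧
  (∀ᵐ x ∂(volume.restrict Ω), 0 < v x) ∧
  ∃ Dv : EuclideanSpace ℝ (Fin N) → EuclideanSpace ℝ (Fin N), HasH10Gradient Ω v Dv ∧
    ∀ (ψ : EuclideanSpace ℝ (Fin N) → ℝ)
      (Dψ : EuclideanSpace ℝ (Fin N) → EuclideanSpace ℝ (Fin N)), HasH10Gradient Ω ψ Dψ →
      IntegrableOn (fun x => a x * g (v x) ^ (-γ) * deriv g (v x) * ψ x) Ω ∧
      IntegrableOn (fun x => g (v x) ^ p * deriv g (v x) * ψ x) Ω ∧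
      ∫ x in Ω, inner ℝ (Dv x) (Dψ x) =
        (∫ x in Ω, a x * g (v x) ^ (-γ) * deriv g (v x) * ψ x) +
          lam * ∫ x in Ω, g (v x) ^ p * deriv g (v x) * ψ x

/-- `u` is a (positive, bounded, weak) solution of
`-Δu - Δ(u²)u = a(x) u^{-γ} + lam u^p` in `Ω`, `u > 0` in `Ω`, `u = 0` on `∂Ω`.
The integrability of `2 u |∇u|² ψ` is what makes the left-hand side of the weak formulation
meaningful; the other part `(1 + 2u²) ∇u · ∇ψ` is integrable since `u` is bounded. -/
def IsSolutionP {N : ℕ} (Ω : Set (EuclideanSpace ℝ (Fin N)))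
    (a : EuclideanSpace ℝ (Fin N) → ℝ) (γ p lam : ℝ)
    (u : EuclideanSpace ℝ (Fin N) → ℝ) : Prop :=
  MemLp u ∞ (volume.restrict Ω) ∧
  (∀ᵐ x ∂(volume.restrict Ω), 0 < u x) ∧
  ∃ Du : EuclideanSpace ℝ (Fin N) → EuclideanSpace ℝ (Fin N), HasH10Gradient Ω u Du ∧
    ∀ (ψ : EuclideanSpace ℝ (Fin N) → ℝ)
      (Dψ : EuclideanSpace ℝ (Fin N) → EuclideanSpace ℝ (Fin N)), HasH10Gradient Ω ψ Dψ →
      IntegrableOn (fun x => 2 * u x * ‖Du x‖ ^ 2 * ψ x) Ω ∧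
      IntegrableOn (fun x => a x * u x ^ (-γ) * ψ x) Ω ∧
      IntegrableOn (fun x => u x ^ p * ψ x) Ω ∧
      ∫ x in Ω, ((1 + 2 * u x ^ 2) * inner ℝ (Du x) (Dψ x) + 2 * u x * ‖Du x‖ ^ 2 * ψ x) =
        (∫ x in Ω, a x * u x ^ (-γ) * ψ x) + lam * ∫ x in Ω, u x ^ p * ψ x

end QuasilinearSingular

namespace QuasilinearSingular

/-! ### Convergence in `L²` -/

section Convergence

variable {α E : Type*} [MeasurableSpace α] [NormedAddCommGroup E] {μ : Measure α}

/-! The argument is a Picone-type one. For `-Δv = f` one would like to test with `φ² / v`, where `φ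
∈ C_c^∞(Ω)`, and obtain `∫ (f / v) φ² ≤ ∫ |∇φ|²`. Since `1 / v` may blow up, it is replaced by
`F(v)` with `F = profile`, which is smooth on all of `ℝ`, has bounded derivative and satisfies `F² ≤
-F'` on `[0, ∞)`. Completing a square then gives the same bound, and `φ² F(v)` is admissible by
`HasH10Gradient.testFunction_mul_comp`. Problem `(P)` is treated directly, without the change of
variables: `cubicProfile` absorbs both the weight `1 + 2u²` and the quadratic gradient term.

In both cases (`exists_energy_estimate`) there are `w > 0` and `k ≥ 1 / (9 (1 + w³))` with `∫ (a
w^(-γ) + λ w^p) k φ² ≤ 2 ∫ |∇φ|²`. The right-hand side does not depend on `λ` or on the solution. On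
the left, the singular term is large for small `w`, the power term is large elsewhere once `λ` is
large, and `p ≥ 3` compensates the cubic decay allowed for `k` at infinity
(`min_mul_le_singular_add_power`). For one fixed `φ` and large `λ` the inequality fails. -/

theorem tendsto_eLpNorm_zero_of_norm_le_mul {F : Type*} [NormedAddCommGroup F]
    {f : ℕ → α → E} {h : ℕ → α → F} {C : ℝ} {p : ℝ≥0∞}
    (hle : ∀ n, ∀ᵐ x ∂μ, ‖f n x‖ ≤ C * ‖h n x‖)
    (hh : Tendsto (fun n => eLpNorm (h n) p μ) atTop (𝓝 0)) :
    Tendsto (fun n => eLpNorm (f n) p μ) atTop (𝓝 0) := by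
  have hlim := ENNReal.Tendsto.const_mul (a := ENNReal.ofReal C) hh
    (Or.inr ENNReal.ofReal_ne_top)
  rw [mul_zero] at hlim
  exact tendsto_of_tendsto_of_tendsto_of_le_of_le tendsto_const_nhds hlim
    (fun _ => zero_le) (fun n => eLpNorm_le_mul_eLpNorm_of_ae_le_mul (hle n) p)

theorem tendsto_eLpNorm_zero_add {f h : ℕ → α → E}
    (hf : ∀ n, AEStronglyMeasurable (f n) μ) (hh : ∀ n, AEStronglyMeasurable (h n) μ)
    (hf0 : Tendsto (fun n => eLpNorm (f n) 2 μ) atTop (𝓝 0))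
    (hh0 : Tendsto (fun n => eLpNorm (h n) 2 μ) atTop (𝓝 0)) :
    Tendsto (fun n => eLpNorm (fun x => f n x + h n x) 2 μ) atTop (𝓝 0) := by
  have hlim := hf0.add hh0
  rw [add_zero] at hlim
  exact tendsto_of_tendsto_of_tendsto_of_le_of_le tendsto_const_nhds hlim
    (fun _ => zero_le) (fun n => eLpNorm_add_le (hf n) (hh n) one_le_two)

/-- Dominated convergence applied to the squared norms. -/
theorem tendsto_eLpNorm_zero_of_dominated {F : Type*} [NormedAddCommGroup F]
    {f : ℕ → α → E} {b : α → F} {C : ℝ} (hf : ∀ n, AEStronglyMeasurable (f n) μ)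
    (hb : MemLp b 2 μ) (hle : ∀ n, ∀ᵐ x ∂μ, ‖f n x‖ ≤ C * ‖b x‖)
    (hlim : ∀ᵐ x ∂μ, Tendsto (fun n => f n x) atTop (𝓝 0)) :
    Tendsto (fun n => eLpNorm (f n) 2 μ) atTop (𝓝 0) := by
  have hCb : MemLp (fun x => C * ‖b x‖) 2 μ := hb.norm.const_mul C
  have key : Tendsto (fun n => ∫⁻ x, ‖f n x‖ₑ ^ (2 : ℝ) ∂μ) atTop (𝓝 (∫⁻ _, 0 ∂μ)) := by
    apply tendsto_lintegral_of_dominated_convergence' (fun x => ‖C * ‖b x‖‖ₑ ^ (2 : ℝ))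
    · exact fun n => (hf n).enorm.pow_const _
    · intro n
      filter_upwards [hle n] with x hx
      gcongr
      rw [enorm_le_iff_norm_le]
      exact hx.trans (le_abs_self _)
    · have := lintegral_rpow_enorm_lt_top_of_eLpNorm_lt_top (by norm_num) (by norm_num) hCb.2
      simpa using this.ne
    · filter_upwards [hlim] with x hx
      have h0 : Tendsto (fun n => ‖f n x‖ₑ) atTop (𝓝 0) := by
        simpa [Function.comp_def] using (continuous_enorm.tendsto _).comp hx
      have := ((ENNReal.continuous_rpow_const (y := 2)).tendsto 0).comp h0
      simpa [Function.comp_def] using this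
  rw [lintegral_zero] at key
  have h2 := ((ENNReal.continuous_rpow_const (y := 1 / 2)).tendsto 0).comp key
  rw [ENNReal.zero_rpow_of_pos (by norm_num)] at h2
  refine h2.congr fun n => ?_
  rw [eLpNorm_eq_lintegral_rpow_enorm_toReal (by norm_num) (by norm_num)]
  simp

/-- On a finite measure space `L²` convergence implies `L¹` convergence. This passes to the limit in
integrals against a fixed test function. -/
theorem tendsto_integral_of_norm_sub_le [IsFiniteMeasure μ] {f : ℕ → α → E} {h : α → E}
    {T : ℕ → α → ℝ} {S : α → ℝ} {C : ℝ}
    (hT : ∀ n, Integrable (T n) μ) (hS : AEStronglyMeasurable S μ)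
    (hle : ∀ n, ∀ᵐ x ∂μ, ‖T n x - S x‖ ≤ C * ‖f n x - h x‖)
    (hlim : Tendsto (fun n => eLpNorm (fun x => f n x - h x) 2 μ) atTop (𝓝 0)) :
    Tendsto (fun n => ∫ x, T n x ∂μ) atTop (𝓝 (∫ x, S x ∂μ)) := by
  refine tendsto_integral_of_L1' S hS (Eventually.of_forall hT) ?_
  have h2 : Tendsto (fun n => eLpNorm (T n - S) 2 μ) atTop (𝓝 0) :=
    tendsto_eLpNorm_zero_of_norm_le_mul hle hlim
  have h3 := ENNReal.Tendsto.mul_const (b := μ univ ^ (1 / (1 : ℝ≥0∞).toReal -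
    1 / (2 : ℝ≥0∞).toReal)) h2
    (Or.inr (ENNReal.rpow_ne_top_of_nonneg (by norm_num) (measure_ne_top μ univ)))
  rw [zero_mul] at h3
  exact tendsto_of_tendsto_of_tendsto_of_le_of_le tendsto_const_nhds h3
    (fun _ => zero_le) (fun n => eLpNorm_le_eLpNorm_mul_rpow_measure_univ one_le_two
      ((hT n).1.sub hS))

end Convergence

/-! ### Test functions and Sobolev functions -/

section Sobolev

variable {N : ℕ} {Ω : Set (EuclideanSpace ℝ (Fin N))}

theorem continuous_gradient_of_contDiff {φ : EuclideanSpace ℝ (Fin N) → ℝ}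
    (hφ : ContDiff ℝ ∞ φ) : Continuous (gradient φ) :=
  (InnerProductSpace.toDual ℝ _).symm.continuous.comp (hφ.continuous_fderiv (by simp))

theorem inner_gradient_left (φ : EuclideanSpace ℝ (Fin N) → ℝ)
    (x w : EuclideanSpace ℝ (Fin N)) : inner ℝ (gradient φ x) w = fderiv ℝ φ x w := by
  rw [gradient, InnerProductSpace.toDual_symm_apply]

theorem gradient_mul_comp {η φ : EuclideanSpace ℝ (Fin N) → ℝ} {F : ℝ → ℝ}
    {x : EuclideanSpace ℝ (Fin N)} (hη : DifferentiableAt ℝ η x)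
    (hφ : DifferentiableAt ℝ φ x) (hF : DifferentiableAt ℝ F (φ x)) :
    gradient (fun y => η y * F (φ y)) x =
      F (φ x) • gradient η x + (η x * deriv F (φ x)) • gradient φ x := by
  refine ext_inner_right ℝ fun w => ?_
  have h := hη.hasFDerivAt.mul (hF.hasDerivAt.comp_hasFDerivAt x hφ.hasFDerivAt)
  rw [inner_gradient_left, inner_add_left, real_inner_smul_left, real_inner_smul_left,
    inner_gradient_left, inner_gradient_left]
  have h' : fderiv ℝ (fun y => η y * F (φ y)) x = _ := h.fderiv
  rw [h']
  simp
  ring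

theorem gradient_sq {φ : EuclideanSpace ℝ (Fin N) → ℝ}
    {x : EuclideanSpace ℝ (Fin N)} (hφ : DifferentiableAt ℝ φ x) :
    gradient (fun y => φ y ^ 2) x = (2 * φ x) • gradient φ x := by
  refine ext_inner_right ℝ fun w => ?_
  have h' : fderiv ℝ (fun y => φ y ^ 2) x = _ := (hφ.hasFDerivAt.pow 2).fderiv
  rw [inner_gradient_left, real_inner_smul_left, inner_gradient_left, h']
  simp

namespace IsTestFunction

variable {φ : EuclideanSpace ℝ (Fin N) → ℝ}

theorem exists_bound (hφ : IsTestFunction Ω φ) : ∃ C, ∀ x, ‖φ x‖ ≤ C :=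
  hφ.contDiff.continuous.bounded_above_of_compact_support hφ.hasCompactSupport

theorem hasCompactSupport_gradient (hφ : IsTestFunction Ω φ) :
    HasCompactSupport (gradient φ) :=
  (hφ.hasCompactSupport.fderiv ℝ).comp_left (map_zero (InnerProductSpace.toDual ℝ _).symm)

theorem exists_bound_gradient (hφ : IsTestFunction Ω φ) : ∃ C, ∀ x, ‖gradient φ x‖ ≤ C :=
  (continuous_gradient_of_contDiff hφ.contDiff).bounded_above_of_compact_support
    hφ.hasCompactSupport_gradient

theorem mul_right (hφ : IsTestFunction Ω φ) {f : EuclideanSpace ℝ (Fin N) → ℝ}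
    (hf : ContDiff ℝ ∞ f) : IsTestFunction Ω (fun x => φ x * f x) where
  contDiff := hφ.contDiff.mul hf
  hasCompactSupport := hφ.hasCompactSupport.mul_right
  tsupport_subset := (tsupport_mul_subset_left (g := f)).trans hφ.tsupport_subset

theorem sq (hφ : IsTestFunction Ω φ) : IsTestFunction Ω (fun x => φ x ^ 2) := by
  simpa only [pow_two] using hφ.mul_right hφ.contDiff

theorem integral_mul_fderiv (hφ : IsTestFunction Ω φ)
    {f : EuclideanSpace ℝ (Fin N) → ℝ} (hf : ContDiff ℝ ∞ f)
    (w : EuclideanSpace ℝ (Fin N)) :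
    ∫ x in Ω, f x * fderiv ℝ φ x w = - ∫ x in Ω, inner ℝ (gradient f x) w * φ x := by
  have hzero : ∀ x ∉ Ω, x ∉ tsupport φ := fun x hx h => hx (hφ.tsupport_subset h)
  have hcφ : HasCompactSupport (fun x => fderiv ℝ φ x w) :=
    hφ.hasCompactSupport.fderiv_apply ℝ w
  have hdφ : Continuous (fun x => fderiv ℝ φ x w) :=
    (hφ.contDiff.continuous_fderiv (by simp)).clm_apply continuous_const
  have hdf : Continuous (fun x => fderiv ℝ f x w) :=
    (hf.continuous_fderiv (by simp)).clm_apply continuous_const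
  -- Both integrands vanish off `Ω`, so the integration by parts takes place on the whole space and
  -- no boundary term arises.
  rw [setIntegral_eq_integral_of_forall_compl_eq_zero,
    setIntegral_eq_integral_of_forall_compl_eq_zero]
  · simp only [inner_gradient_left]
    apply integral_mul_fderiv_eq_neg_fderiv_mul_of_integrable
    · exact (hdf.mul hφ.contDiff.continuous).integrable_of_hasCompactSupport
        hφ.hasCompactSupport.mul_left
    · exact (hf.continuous.mul hdφ).integrable_of_hasCompactSupport hcφ.mul_left
    · exact (hf.continuous.mul hφ.contDiff.continuous).integrable_of_hasCompactSupport
        hφ.hasCompactSupport.mul_left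
    · exact fun x _ => hf.contDiffAt.differentiableAt (by simp)
    · exact fun x _ => hφ.contDiff.contDiffAt.differentiableAt (by simp)
  · intro x hx
    rw [image_eq_zero_of_notMem_tsupport (hzero x hx), mul_zero]
  · intro x hx
    have : fderiv ℝ φ x = 0 := image_eq_zero_of_notMem_tsupport
      fun h => hzero x hx (tsupport_fderiv_subset ℝ h)
    rw [this, zero_apply, mul_zero]

end IsTestFunction

/-- The weak formulation of the gradient follows from approximation by test functions. -/
theorem hasH10Gradient_of_approx [IsFiniteMeasure (volume.restrict Ω)]
    {v : EuclideanSpace ℝ (Fin N) → ℝ}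
    {G : EuclideanSpace ℝ (Fin N) → EuclideanSpace ℝ (Fin N)}
    (hv : MemLp v 2 (volume.restrict Ω)) (hG : MemLp G 2 (volume.restrict Ω))
    {φ : ℕ → EuclideanSpace ℝ (Fin N) → ℝ} (hφ : ∀ n, IsTestFunction Ω (φ n))
    (h1 : Tendsto (fun n => eLpNorm (fun x => φ n x - v x) 2 (volume.restrict Ω)) atTop (𝓝 0))
    (h2 : Tendsto (fun n => eLpNorm (fun x => gradient (φ n) x - G x) 2 (volume.restrict Ω))
      atTop (𝓝 0)) :
    HasH10Gradient Ω v G where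
  memLp := hv
  memLp_gradient := hG
  exists_approx := ⟨φ, hφ, h1, h2⟩
  hasWeakGradient :=
    { locallyIntegrableOn :=
        IntegrableOn.locallyIntegrableOn (hv.integrable one_le_two)
      locallyIntegrableOn_gradient :=
        IntegrableOn.locallyIntegrableOn (hG.integrable one_le_two)
      integral_eq := by
        intro ζ hζ w
        obtain ⟨A, hA⟩ := hζ.exists_bound
        obtain ⟨B, hB⟩ := hζ.exists_bound_gradient
        have hdζ : Continuous (fun x => fderiv ℝ ζ x w) :=
          (hζ.contDiff.continuous_fderiv (by simp)).clm_apply continuous_const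
        have hcζ : HasCompactSupport (fun x => fderiv ℝ ζ x w) :=
          hζ.hasCompactSupport.fderiv_apply ℝ w
        have l1 : Tendsto (fun n => ∫ x in Ω, φ n x * fderiv ℝ ζ x w) atTop
            (𝓝 (∫ x in Ω, v x * fderiv ℝ ζ x w)) := by
          refine tendsto_integral_of_norm_sub_le (C := B * ‖w‖) (fun n => ?_)
            (hv.1.mul hdζ.aestronglyMeasurable) (fun n => Eventually.of_forall fun x => ?_) h1
          · exact (((hφ n).contDiff.continuous.mul hdζ).integrable_of_hasCompactSupport
              hcζ.mul_left).integrableOn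
          · rw [← sub_mul, norm_mul, mul_comm]
            gcongr
            rw [← inner_gradient_left]
            exact (norm_inner_le_norm _ _).trans (by gcongr; exact hB x)
        have l2 : Tendsto (fun n => ∫ x in Ω, inner ℝ (gradient (φ n) x) w * ζ x) atTop
            (𝓝 (∫ x in Ω, inner ℝ (G x) w * ζ x)) := by
          refine tendsto_integral_of_norm_sub_le (C := ‖w‖ * A) (fun n => ?_)
            ((hG.1.inner aestronglyMeasurable_const).mul
              hζ.contDiff.continuous.aestronglyMeasurable)
            (fun n => Eventually.of_forall fun x => ?_) h2
          · have hc : Continuous fun x => inner ℝ (gradient (φ n) x) w :=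
              (continuous_gradient_of_contDiff (hφ n).contDiff).inner continuous_const
            exact ((hc.mul hζ.contDiff.continuous).integrable_of_hasCompactSupport
              hζ.hasCompactSupport.mul_left).integrableOn
          · rw [← sub_mul, ← inner_sub_left, norm_mul]
            calc _ ≤ (‖gradient (φ n) x - G x‖ * ‖w‖) * A := by
                  gcongr
                  · exact norm_inner_le_norm _ _
                  · exact hA x
              _ = _ := by ring
        refine tendsto_nhds_unique l1 (l2.neg.congr fun n => ?_)
        rw [hζ.integral_mul_fderiv (hφ n).contDiff] }

/-- If `v ∈ H₀¹(Ω)`, `η ∈ C_c^∞(Ω)` and `F` is smooth with bounded derivative, then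
`η F(v) ∈ H₀¹(Ω)`, with the gradient given by the product and chain rules. -/
theorem HasH10Gradient.testFunction_mul_comp [IsFiniteMeasure (volume.restrict Ω)]
    {v : EuclideanSpace ℝ (Fin N) → ℝ}
    {Dv : EuclideanSpace ℝ (Fin N) → EuclideanSpace ℝ (Fin N)}
    (hv : HasH10Gradient Ω v Dv) {η : EuclideanSpace ℝ (Fin N) → ℝ}
    (hη : IsTestFunction Ω η) {F : ℝ → ℝ} (hF : ContDiff ℝ ∞ F) {L : ℝ}
    (hL : ∀ s, |deriv F s| ≤ L) :
    HasH10Gradient Ω (fun x => η x * F (v x))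
      (fun x => F (v x) • gradient η x + (η x * deriv F (v x)) • Dv x) := by
  obtain ⟨A, hA⟩ := hη.exists_bound
  obtain ⟨B, hB⟩ := hη.exists_bound_gradient
  have hA0 : 0 ≤ A := (norm_nonneg _).trans (hA 0)
  have hB0 : 0 ≤ B := (norm_nonneg _).trans (hB 0)
  have hL0 : 0 ≤ L := (abs_nonneg _).trans (hL 0)
  have hFd : Differentiable ℝ F := hF.differentiable (by simp)
  have hF' : Continuous (deriv F) := hF.continuous_deriv (by simp)
  have hLip : ∀ s t, ‖F s - F t‖ ≤ L * ‖s - t‖ := fun s t =>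
    convex_univ.norm_image_sub_le_of_norm_deriv_le (fun x _ => hFd x) (fun x _ => hL x)
      (mem_univ t) (mem_univ s)
  obtain ⟨φ₀, hφ₀, h1₀, h2₀⟩ := hv.exists_approx
  -- An almost everywhere convergent subsequence is needed because `deriv F` is only known to be
  -- continuous and bounded along the approximation: `deriv F (φ n)` converges pointwise, with no
  -- rate.
  have hmeas : TendstoInMeasure (volume.restrict Ω) φ₀ atTop v :=
    tendstoInMeasure_of_tendsto_eLpNorm (p := 2) two_ne_zero
      (fun n => (hφ₀ n).contDiff.continuous.aestronglyMeasurable) hv.memLp.1 h1₀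
  obtain ⟨ns, hns, hae⟩ := hmeas.exists_seq_tendsto_ae
  set φ : ℕ → EuclideanSpace ℝ (Fin N) → ℝ := fun n => φ₀ (ns n)
  have hφ : ∀ n, IsTestFunction Ω (φ n) := fun n => hφ₀ (ns n)
  have h1 : Tendsto (fun n => eLpNorm (fun x => φ n x - v x) 2 (volume.restrict Ω))
    atTop (𝓝 0) := h1₀.comp hns.tendsto_atTop
  have h2 : Tendsto (fun n => eLpNorm (fun x => gradient (φ n) x - Dv x) 2
    (volume.restrict Ω)) atTop (𝓝 0) := h2₀.comp hns.tendsto_atTop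
  have mη : AEStronglyMeasurable η (volume.restrict Ω) :=
    hη.contDiff.continuous.aestronglyMeasurable
  have mdη : AEStronglyMeasurable (gradient η) (volume.restrict Ω) :=
    (continuous_gradient_of_contDiff hη.contDiff).aestronglyMeasurable
  have mFv : AEStronglyMeasurable (fun x => F (v x)) (volume.restrict Ω) :=
    hF.continuous.comp_aestronglyMeasurable hv.memLp.1
  have mF'v : AEStronglyMeasurable (fun x => deriv F (v x)) (volume.restrict Ω) :=
    hF'.comp_aestronglyMeasurable hv.memLp.1
  have mφ : ∀ n, AEStronglyMeasurable (φ n) (volume.restrict Ω) := fun n =>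
    (hφ n).contDiff.continuous.aestronglyMeasurable
  have mdφ : ∀ n, AEStronglyMeasurable (gradient (φ n)) (volume.restrict Ω) := fun n =>
    (continuous_gradient_of_contDiff (hφ n).contDiff).aestronglyMeasurable
  have mFφ : ∀ n, AEStronglyMeasurable (fun x => F (φ n x)) (volume.restrict Ω) := fun n =>
    hF.continuous.comp_aestronglyMeasurable (mφ n)
  have mF'φ : ∀ n, AEStronglyMeasurable (fun x => deriv F (φ n x)) (volume.restrict Ω) :=
    fun n => hF'.comp_aestronglyMeasurable (mφ n)
  have hFv : MemLp (fun x => F (v x)) 2 (volume.restrict Ω) := by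
    have hs : MemLp (fun x => F (v x) - F 0) 2 (volume.restrict Ω) :=
      hv.memLp.of_le_mul (mFv.sub aestronglyMeasurable_const)
        (Eventually.of_forall fun x => by simpa using hLip (v x) 0)
    simpa [Pi.add_def] using hs.add (memLp_const (F 0))
  refine hasH10Gradient_of_approx (φ := fun n x => η x * F (φ n x)) ?_ ?_
    (fun n => hη.mul_right (hF.comp (hφ n).contDiff)) ?_ ?_
  · refine hFv.of_le_mul (c := A) (mη.mul mFv) (Eventually.of_forall fun x => ?_)
    rw [norm_mul]
    gcongr
    exact hA x
  · refine MemLp.add ?_ ?_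
    · refine hFv.of_le_mul (c := B) (mFv.smul mdη) (Eventually.of_forall fun x => ?_)
      rw [norm_smul, mul_comm]
      gcongr
      exact hB x
    · refine hv.memLp_gradient.of_le_mul (c := A * L)
        ((mη.mul mF'v).smul hv.memLp_gradient.1) (Eventually.of_forall fun x => ?_)
      rw [norm_smul, norm_mul]
      gcongr
      · exact hA x
      · exact hL (v x)
  · refine tendsto_eLpNorm_zero_of_norm_le_mul (C := A * L)
      (fun n => Eventually.of_forall fun x => ?_) h1
    rw [← mul_sub, norm_mul, mul_assoc]
    gcongr
    · exact hA x
    · exact hLip _ _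
  -- The first two terms are controlled by the `L²` convergence of `φ n` and of its gradient; the
  -- last one, with `Dv` fixed, by dominated convergence.
  · have hdecomp : ∀ n x, gradient (fun y => η y * F (φ n y)) x -
        (F (v x) • gradient η x + (η x * deriv F (v x)) • Dv x) =
        ((F (φ n x) - F (v x)) • gradient η x +
          (η x * deriv F (φ n x)) • (gradient (φ n) x - Dv x)) +
          (η x * (deriv F (φ n x) - deriv F (v x))) • Dv x := by
      intro n x
      rw [gradient_mul_comp (hη.contDiff.differentiable (by simp) x)
        ((hφ n).contDiff.differentiable (by simp) x) (hFd _)]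
      module
    simp only [hdecomp]
    have m1 : ∀ n, AEStronglyMeasurable (fun x => (F (φ n x) - F (v x)) • gradient η x)
        (volume.restrict Ω) := fun n => ((mFφ n).sub mFv).smul mdη
    have m2 : ∀ n, AEStronglyMeasurable
        (fun x => (η x * deriv F (φ n x)) • (gradient (φ n) x - Dv x))
        (volume.restrict Ω) := fun n =>
      (mη.mul (mF'φ n)).smul ((mdφ n).sub hv.memLp_gradient.1)
    have m3 : ∀ n, AEStronglyMeasurable
        (fun x => (η x * (deriv F (φ n x) - deriv F (v x))) • Dv x)
        (volume.restrict Ω) := fun n =>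
      (mη.mul ((mF'φ n).sub mF'v)).smul hv.memLp_gradient.1
    refine tendsto_eLpNorm_zero_add (fun n => (m1 n).add (m2 n)) m3
      (tendsto_eLpNorm_zero_add m1 m2 ?_ ?_) ?_
    · refine tendsto_eLpNorm_zero_of_norm_le_mul (C := B * L)
        (fun n => Eventually.of_forall fun x => ?_) h1
      rw [norm_smul, mul_comm, mul_assoc]
      gcongr
      · exact hB x
      · exact hLip _ _
    · refine tendsto_eLpNorm_zero_of_norm_le_mul (C := A * L)
        (fun n => Eventually.of_forall fun x => ?_) h2
      rw [norm_smul, norm_mul]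
      gcongr
      · exact hA x
      · exact hL _
    · refine tendsto_eLpNorm_zero_of_dominated (C := A * (L + L)) m3 hv.memLp_gradient
        (fun n => Eventually.of_forall fun x => ?_) ?_
      · rw [norm_smul, norm_mul]
        gcongr
        · exact hA x
        · exact (norm_sub_le _ _).trans (add_le_add (hL _) (hL _))
      · filter_upwards [hae] with x hx
        have hd : Tendsto (fun n => deriv F (φ n x) - deriv F (v x)) atTop (𝓝 0) := by
          simpa using ((hF'.tendsto (v x)).comp hx).sub_const (deriv F (v x))
        simpa using (hd.const_mul (η x)).smul_const (Dv x)

end Sobolev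

/-! ### Profiles of the Picone-type test functions -/

/-- The smooth function `s ↦ 1 / (s + √(1 + s²))`. -/
noncomputable def profile (s : ℝ) : ℝ := √(1 + s ^ 2) - s

/-- The smooth function `s ↦ 1 / ((1 + s²) (s + √(1 + s²)))`. -/
noncomputable def cubicProfile (s : ℝ) : ℝ := profile s / (1 + s ^ 2)

theorem abs_lt_sqrt_one_add_sq (s : ℝ) : |s| < √(1 + s ^ 2) := by
  rw [Real.lt_sqrt (abs_nonneg s), sq_abs]
  linarith

theorem profile_pos (s : ℝ) : 0 < profile s :=
  sub_pos.2 ((le_abs_self s).trans_lt (abs_lt_sqrt_one_add_sq s))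

theorem profile_mul_add (s : ℝ) : profile s * (s + √(1 + s ^ 2)) = 1 := by
  have h : √(1 + s ^ 2) ^ 2 = 1 + s ^ 2 := Real.sq_sqrt (by positivity)
  rw [profile]
  linear_combination h

theorem contDiff_profile : ContDiff ℝ ∞ profile :=
  ((contDiff_const.add (contDiff_id.pow 2)).sqrt fun s => by positivity).sub contDiff_id

theorem contDiff_cubicProfile : ContDiff ℝ ∞ cubicProfile :=
  contDiff_profile.div (contDiff_const.add (contDiff_id.pow 2)) fun s => by positivity

theorem hasDerivAt_profile (s : ℝ) :
    HasDerivAt profile (-(profile s / √(1 + s ^ 2))) s := by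
  have h1 : HasDerivAt (fun s : ℝ => 1 + s ^ 2) (2 * s) s := by
    simpa using (hasDerivAt_pow 2 s).const_add 1
  have h2 := (h1.sqrt (by positivity)).sub (hasDerivAt_id s)
  have hr : √(1 + s ^ 2) ≠ 0 := by positivity
  refine h2.congr_deriv ?_
  rw [profile]
  field_simp
  ring

theorem hasDerivAt_cubicProfile (s : ℝ) :
    HasDerivAt cubicProfile
      (-(profile s * (√(1 + s ^ 2) + 2 * s) / (1 + s ^ 2) ^ 2)) s := by
  have h1 : HasDerivAt (fun s : ℝ => 1 + s ^ 2) (2 * s) s := by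
    simpa using (hasDerivAt_pow 2 s).const_add 1
  have h2 := (hasDerivAt_profile s).div h1 (by positivity)
  have hr : √(1 + s ^ 2) ≠ 0 := by positivity
  have hq : (1 + s ^ 2) ≠ 0 := by positivity
  have hsq : √(1 + s ^ 2) ^ 2 = 1 + s ^ 2 := Real.sq_sqrt (by positivity)
  refine h2.congr_deriv ?_
  have h3 : 1 / √(1 + s ^ 2) = √(1 + s ^ 2) / (1 + s ^ 2) := by
    rw [div_eq_div_iff hr hq, ← pow_two, hsq, one_mul]
  rw [div_eq_mul_one_div (profile s), h3]
  generalize √(1 + s ^ 2) = r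
  field_simp
  ring

theorem abs_deriv_profile_le (s : ℝ) : |deriv profile s| ≤ 2 := by
  have hr : 0 < √(1 + s ^ 2) := by positivity
  rw [(hasDerivAt_profile s).deriv, abs_neg, abs_div, abs_of_pos hr,
    abs_of_pos (profile_pos s), div_le_iff₀ hr, profile]
  linarith [(neg_abs_le s), abs_lt_sqrt_one_add_sq s]

theorem abs_deriv_cubicProfile_le (s : ℝ) : |deriv cubicProfile s| ≤ 6 := by
  have hr : 0 < √(1 + s ^ 2) := by positivity
  have hsq : √(1 + s ^ 2) ^ 2 = 1 + s ^ 2 := Real.sq_sqrt (by positivity)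
  have h1 : profile s ≤ 2 * √(1 + s ^ 2) := by
    rw [profile]
    linarith [(neg_abs_le s), abs_lt_sqrt_one_add_sq s]
  have h2 : |√(1 + s ^ 2) + 2 * s| ≤ 3 * √(1 + s ^ 2) := by
    rw [abs_le]
    constructor <;>
      linarith [(neg_abs_le s), le_abs_self s, abs_lt_sqrt_one_add_sq s]
  rw [(hasDerivAt_cubicProfile s).deriv, abs_neg, abs_div, abs_mul,
    abs_of_pos (profile_pos s), abs_of_pos (by positivity : (0 : ℝ) < (1 + s ^ 2) ^ 2),
    div_le_iff₀ (by positivity)]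
  calc profile s * |√(1 + s ^ 2) + 2 * s| ≤ (2 * √(1 + s ^ 2)) * (3 * √(1 + s ^ 2)) := by
        gcongr
    _ = 6 * (1 + s ^ 2) := by linear_combination 6 * hsq
    _ ≤ 6 * (1 + s ^ 2) ^ 2 := by nlinarith [sq_nonneg s, sq_nonneg (s ^ 2)]

theorem profile_mul_sqrt_le_one {s : ℝ} (hs : 0 ≤ s) : profile s * √(1 + s ^ 2) ≤ 1 := by
  nlinarith [profile_mul_add s, mul_nonneg (profile_pos s).le hs]

/-- Since `-F' = F / √(1 + s²)`, this amounts to `F √(1 + s²) ≤ 1`. It is the smooth substitute for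
the identity `(1/s)² = -(1/s)'`. -/
theorem profile_sq_le_neg_deriv {s : ℝ} (hs : 0 ≤ s) :
    profile s ^ 2 ≤ -deriv profile s := by
  have hr : 0 < √(1 + s ^ 2) := by positivity
  rw [(hasDerivAt_profile s).deriv, neg_neg, le_div_iff₀ hr]
  nlinarith [profile_mul_sqrt_le_one hs, profile_pos s]

/-- The right-hand side is minus the coefficient of `φ² |∇u|²` when `(P)` is tested with `φ²
cubicProfile(u)`. It dominates the square of the coefficient of the cross term, again because
`profile s * √(1 + s²) ≤ 1`. -/
theorem cubicProfile_sq_le {s : ℝ} (hs : 0 ≤ s) :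
    ((1 + 2 * s ^ 2) * cubicProfile s) ^ 2 / 2 ≤
      -((1 + 2 * s ^ 2) * deriv cubicProfile s + 2 * s * cubicProfile s) := by
  have hr : 0 < √(1 + s ^ 2) := by positivity
  have hsq : √(1 + s ^ 2) ^ 2 = 1 + s ^ 2 := Real.sq_sqrt (by positivity)
  have hF := profile_pos s
  have hFr := profile_mul_sqrt_le_one hs
  rw [(hasDerivAt_cubicProfile s).deriv, cubicProfile]
  have e1 : ((1 + 2 * s ^ 2) * (profile s / (1 + s ^ 2))) ^ 2 / 2 =
      profile s * (profile s * (1 + 2 * s ^ 2) ^ 2 / 2) / (1 + s ^ 2) ^ 2 := by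
    field_simp
  have e2 : -((1 + 2 * s ^ 2) * -(profile s * (√(1 + s ^ 2) + 2 * s) / (1 + s ^ 2) ^ 2) +
      2 * s * (profile s / (1 + s ^ 2))) =
      profile s * ((1 + 2 * s ^ 2) * √(1 + s ^ 2) + 2 * s ^ 3) / (1 + s ^ 2) ^ 2 := by
    field_simp
    ring
  rw [e1, e2]
  gcongr
  have h3 : profile s * (1 + 2 * s ^ 2) / 2 ≤ √(1 + s ^ 2) := by
    calc profile s * (1 + 2 * s ^ 2) / 2 ≤ profile s * (2 * √(1 + s ^ 2) ^ 2) / 2 := by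
          gcongr
          linarith
      _ = (profile s * √(1 + s ^ 2)) * √(1 + s ^ 2) := by ring
      _ ≤ 1 * √(1 + s ^ 2) := by gcongr
      _ = _ := one_mul _
  have h4 : 0 ≤ 2 * s ^ 3 := by positivity
  calc _ = (1 + 2 * s ^ 2) * (profile s * (1 + 2 * s ^ 2) / 2) := by ring
    _ ≤ (1 + 2 * s ^ 2) * √(1 + s ^ 2) := by gcongr
    _ ≤ _ := by linarith

theorem inv_le_profile {s : ℝ} (hs : 0 ≤ s) : (1 + 2 * s)⁻¹ ≤ profile s := by
  have h : √(1 + s ^ 2) ≤ 1 + s := by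
    rw [Real.sqrt_le_left (by positivity)]
    nlinarith
  rw [inv_le_iff_one_le_mul₀ (by positivity)]
  calc 1 = profile s * (s + √(1 + s ^ 2)) := (profile_mul_add s).symm
    _ ≤ profile s * (1 + 2 * s) :=
        mul_le_mul_of_nonneg_left (by linarith) (profile_pos s).le

theorem inv_le_cubicProfile {s : ℝ} (hs : 0 ≤ s) :
    (9 * (1 + s ^ 3))⁻¹ ≤ cubicProfile s := by
  calc (9 * (1 + s ^ 3))⁻¹ ≤ ((1 + 2 * s) * (1 + s ^ 2))⁻¹ := by
        apply inv_anti₀ (by positivity)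
        nlinarith [mul_nonneg hs (sq_nonneg (s - 1)), sq_nonneg (s - 1), pow_nonneg hs 3]
    _ = (1 + 2 * s)⁻¹ / (1 + s ^ 2) := by rw [mul_inv, div_eq_mul_inv]
    _ ≤ cubicProfile s := by
        rw [cubicProfile]
        gcongr
        exact inv_le_profile hs

/-! ### Estimates for the change of variables -/

theorem gInv_le_mul_sqrt {s : ℝ} (hs : 0 ≤ s) : gInv s ≤ s * √(1 + 2 * s ^ 2) := by
  have h : gInv s ≤ ∫ _ in (0 : ℝ)..s, √(1 + 2 * s ^ 2) := by
    apply intervalIntegral.integral_mono_on hs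
    · exact Continuous.intervalIntegrable (by fun_prop) _ _
    · exact intervalIntegrable_const
    · intro r hr
      have := hr.1
      have := hr.2
      gcongr
  simpa using h

theorem g_pos {t : ℝ} (ht : 0 < t) : 0 < g t := by
  rw [← strictMono_gInv.lt_iff_lt, gInv_g, gInv_zero]
  exact ht

/-- With `w = g t` and `q = √(1 + 2w²)`, one has `g' = 1 / q` and `t ≤ w q`, hence `g' F(t) ≥ 1 / (q
(1 + 2wq))`, whose denominator grows like `w³`. -/
theorem inv_le_deriv_g_mul_profile {t : ℝ} (ht : 0 < t) :
    (9 * (1 + g t ^ 3))⁻¹ ≤ deriv g t * profile t := by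
  have hw := (g_pos ht).le
  have htw : t ≤ g t * √(1 + 2 * g t ^ 2) := by
    simpa only [gInv_g] using gInv_le_mul_sqrt hw
  rw [(hasDerivAt_g t).deriv, sq_abs]
  have hq : 0 < √(1 + 2 * g t ^ 2) := by positivity
  have hsq : √(1 + 2 * g t ^ 2) ^ 2 = 1 + 2 * g t ^ 2 := Real.sq_sqrt (by positivity)
  have hq1 : 1 ≤ √(1 + 2 * g t ^ 2) := by
    rw [Real.one_le_sqrt]
    nlinarith [sq_nonneg (g t)]
  generalize g t = w at *
  generalize √(1 + 2 * w ^ 2) = q at *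
  calc (9 * (1 + w ^ 3))⁻¹ ≤ (q * (1 + 2 * (w * q)))⁻¹ := by
        apply inv_anti₀ (by positivity)
        have h1 : q * (1 + 2 * (w * q)) = q + 2 * w * (1 + 2 * w ^ 2) := by
          rw [← hsq]
          ring
        rw [h1]
        nlinarith [mul_nonneg hw (sq_nonneg (w - 1)), sq_nonneg (w - 1), pow_nonneg hw 3]
    _ = 1 / q * (1 + 2 * (w * q))⁻¹ := by rw [mul_inv, one_div]
    _ ≤ 1 / q * (1 + 2 * t)⁻¹ := by gcongr
    _ ≤ 1 / q * profile t := by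
        gcongr
        exact inv_le_profile ht.le

/-! ### The nonlinearity is uniformly large -/

/-- Three ranges of `w`: below `δ` the singular term suffices, between `δ` and `1` the power term
does because `lam * δ ^ p ≥ δ ^ (-γ)`, and above `1` the growth `w ^ p ≥ w ^ 3` offsets the decay of
`k`. The constant `18` is `9 (1 + 1)`. -/
theorem min_mul_le_singular_add_power {A w k γ p δ lam : ℝ} (hA : 0 < A) (hw : 0 < w)
    (hγ : 0 < γ) (hp : 3 ≤ p) (hδ : 0 < δ) (hδ1 : δ ≤ 1) (hlam : δ ^ (-γ - p) ≤ lam)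
    (hk : (9 * (1 + w ^ 3))⁻¹ ≤ k) :
    min A 1 * (δ ^ (-γ) / 18) ≤ (A * w ^ (-γ) + lam * w ^ p) * k := by
  have hd : 0 < δ ^ (-γ) := by positivity
  have hlam0 : 0 < lam := lt_of_lt_of_le (by positivity) hlam
  have hwγ : 0 < w ^ (-γ) := by positivity
  have hwp : 0 < w ^ p := by positivity
  have hm : 0 < min A 1 := lt_min hA one_pos
  have hX : 0 ≤ A * w ^ (-γ) := by positivity
  have hY : 0 ≤ lam * w ^ p := by positivity
  rcases le_total w 1 with hw1 | hw1
  · have hk' : 1 / 18 ≤ k := by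
      refine le_trans ?_ hk
      rw [one_div]
      gcongr
      have : w ^ 3 ≤ 1 := pow_le_one₀ hw.le hw1
      linarith
    have key : min A 1 * δ ^ (-γ) ≤ A * w ^ (-γ) + lam * w ^ p := by
      rcases le_total w δ with hwδ | hwδ
      · have h1 : δ ^ (-γ) ≤ w ^ (-γ) :=
          Real.rpow_le_rpow_of_nonpos hw hwδ (by linarith)
        have h2 : min A 1 * δ ^ (-γ) ≤ A * w ^ (-γ) := by
          gcongr
          exact min_le_left _ _
        linarith
      · have h1 : δ ^ (-γ) ≤ lam * w ^ p := by
          calc δ ^ (-γ) = δ ^ (-γ - p) * δ ^ p := by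
                rw [← Real.rpow_add hδ]
                ring_nf
            _ ≤ lam * w ^ p := by gcongr
        have h2 : min A 1 * δ ^ (-γ) ≤ 1 * δ ^ (-γ) := by
          gcongr
          exact min_le_right _ _
        linarith
    calc min A 1 * (δ ^ (-γ) / 18) = min A 1 * δ ^ (-γ) * (1 / 18) := by ring
      _ ≤ _ := by gcongr
  · have h1 : w ^ 3 ≤ w ^ p := by
      rw [← Real.rpow_natCast]
      exact Real.rpow_le_rpow_of_exponent_le hw1 (by exact_mod_cast hp)
    have h2 : δ ^ (-γ) ≤ lam :=
      (Real.rpow_le_rpow_of_exponent_ge hδ hδ1 (by linarith)).trans hlam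
    have hw3 : 1 ≤ w ^ 3 := one_le_pow₀ hw1
    have h3 : 1 / 18 ≤ w ^ p * k := by
      calc (1 : ℝ) / 18 ≤ w ^ 3 * (9 * (1 + w ^ 3))⁻¹ := by
            rw [← div_eq_mul_inv, le_div_iff₀ (by positivity)]
            linarith
        _ ≤ _ := by gcongr
    have hk0 : 0 < k := lt_of_lt_of_le (by positivity) hk
    calc min A 1 * (δ ^ (-γ) / 18) ≤ 1 * (δ ^ (-γ) / 18) := by
          gcongr
          exact min_le_right _ _
      _ = δ ^ (-γ) * (1 / 18) := by ring
      _ ≤ lam * (w ^ p * k) := by gcongr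
      _ = (lam * w ^ p) * k := by ring
      _ ≤ _ := by
          gcongr
          linarith

/-! ### Energy estimates for solutions -/

theorem integrable_inner_of_memLp_two {α E : Type*} [MeasurableSpace α] {μ : Measure α}
    [NormedAddCommGroup E] [InnerProductSpace ℝ E] {f h : α → E} (hf : MemLp f 2 μ)
    (hh : MemLp h 2 μ) : Integrable (fun x => inner ℝ (f x) (h x)) μ :=
  (hf.norm.integrable_mul hh.norm).mono' (hf.1.inner hh.1)
    (Eventually.of_forall fun _ => norm_inner_le_norm _ _)

theorem exists_bound_of_memLp_top {α E : Type*} [MeasurableSpace α] {μ : Measure α}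
    [NormedAddCommGroup E] {f : α → E} (hf : MemLp f ∞ μ) :
    ∃ C : ℝ, ∀ᵐ x ∂μ, ‖f x‖ ≤ C := by
  refine ⟨(eLpNorm f ∞ μ).toReal, ?_⟩
  have h : ∀ᵐ x ∂μ, ‖f x‖ₑ ≤ eLpNorm f ∞ μ := by
    rw [eLpNorm_exponent_top]
    exact enorm_ae_le_eLpNormEssSup f μ
  filter_upwards [h] with x hx
  simpa using ENNReal.toReal_mono hf.2.ne hx

section Energy

variable {N : ℕ} {Ω : Set (EuclideanSpace ℝ (Fin N))}

namespace IsTestFunction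

variable {φ : EuclideanSpace ℝ (Fin N) → ℝ}

theorem integrableOn_norm_gradient_sq (hφ : IsTestFunction Ω φ) :
    IntegrableOn (fun x => ‖gradient φ x‖ ^ 2) Ω := by
  have hc : HasCompactSupport (fun x => ‖gradient φ x‖ ^ 2) :=
    hφ.hasCompactSupport_gradient.comp_left (g := fun y => ‖y‖ ^ 2) (by simp)
  exact (((continuous_gradient_of_contDiff hφ.contDiff).norm.pow
    2).integrable_of_hasCompactSupport hc).integrableOn

theorem integrableOn_min_mul_sq (hφ : IsTestFunction Ω φ)
    {a : EuclideanSpace ℝ (Fin N) → ℝ} (ha : AEMeasurable a (volume.restrict Ω))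
    (ha_pos : ∀ᵐ x ∂(volume.restrict Ω), 0 < a x) :
    IntegrableOn (fun x => min (a x) 1 * φ x ^ 2) Ω := by
  refine Integrable.bdd_mul (c := 1) ?_
    (ha.min aemeasurable_const).aestronglyMeasurable ?_
  · exact (hφ.sq.contDiff.continuous.integrable_of_hasCompactSupport
      hφ.sq.hasCompactSupport).integrableOn
  · filter_upwards [ha_pos] with x hx
    rw [Real.norm_of_nonneg (lt_min hx one_pos).le]
    exact min_le_right _ _

end IsTestFunction

/-- The test function is `φ² profile(v)`, with `w = g(v)` and `k = g'(v) profile(v)`. The constant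
`1` would do in place of `2`; `2` is the one shared with `(P)`. -/
theorem IsSolutionQ.exists_energy_estimate [IsFiniteMeasure (volume.restrict Ω)]
    {a : EuclideanSpace ℝ (Fin N) → ℝ} {γ p lam : ℝ}
    {v : EuclideanSpace ℝ (Fin N) → ℝ} (hv : IsSolutionQ Ω a γ p lam v)
    {φ : EuclideanSpace ℝ (Fin N) → ℝ} (hφ : IsTestFunction Ω φ) :
    ∃ w k : EuclideanSpace ℝ (Fin N) → ℝ,
      (∀ᵐ x ∂(volume.restrict Ω), 0 < w x ∧ (9 * (1 + w x ^ 3))⁻¹ ≤ k x) ∧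
      IntegrableOn (fun x => (a x * w x ^ (-γ) + lam * w x ^ p) * k x * φ x ^ 2) Ω ∧
      ∫ x in Ω, (a x * w x ^ (-γ) + lam * w x ^ p) * k x * φ x ^ 2 ≤
        2 * ∫ x in Ω, ‖gradient φ x‖ ^ 2 := by
  obtain ⟨-, hpos, Dv, hDv, hweak⟩ := hv
  have hψ := hDv.testFunction_mul_comp hφ.sq contDiff_profile abs_deriv_profile_le
  obtain ⟨hi1, hi2, heq⟩ := hweak _ _ hψ
  have hsum : ∀ x, a x * g (v x) ^ (-γ) * deriv g (v x) * (φ x ^ 2 * profile (v x)) +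
      lam * (g (v x) ^ p * deriv g (v x) * (φ x ^ 2 * profile (v x))) =
      (a x * g (v x) ^ (-γ) + lam * g (v x) ^ p) * (deriv g (v x) * profile (v x)) *
        φ x ^ 2 := fun x => by ring
  refine ⟨fun x => g (v x), fun x => deriv g (v x) * profile (v x), ?_, ?_, ?_⟩
  · filter_upwards [hpos] with x hx
    exact ⟨g_pos hx, inv_le_deriv_g_mul_profile hx⟩
  · exact (hi1.add (hi2.const_mul lam)).congr (Eventually.of_forall hsum)
  · simp only [← hsum]
    rw [integral_add hi1 (hi2.const_mul lam), integral_const_mul, ← heq,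
      ← integral_const_mul]
    refine integral_mono_ae ?_ (hφ.integrableOn_norm_gradient_sq.const_mul 2) ?_
    · exact integrable_inner_of_memLp_two hDv.memLp_gradient hψ.memLp_gradient
    · filter_upwards [hpos] with x hx
      have h1 := profile_sq_le_neg_deriv hx.le
      -- With `X = φ F(v) ∇v`, the integrand is at most `2 X·∇φ - |X|² = |∇φ|² - |X - ∇φ|²`.
      have h2 := norm_sub_sq_real ((φ x * profile (v x)) • Dv x) (gradient φ x)
      rw [real_inner_smul_left, norm_smul, mul_pow, Real.norm_eq_abs, sq_abs] at h2
      rw [gradient_sq (hφ.contDiff.differentiable (by simp) x), inner_add_right,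
        inner_smul_right, inner_smul_right, inner_smul_right, real_inner_self_eq_norm_sq]
      have h3 : profile (v x) ^ 2 * (φ x ^ 2 * ‖Dv x‖ ^ 2) ≤
          -deriv profile (v x) * (φ x ^ 2 * ‖Dv x‖ ^ 2) := by gcongr
      nlinarith [sq_nonneg ‖(φ x * profile (v x)) • Dv x - gradient φ x‖,
        sq_nonneg ‖gradient φ x‖]

/-- The test function is `φ² cubicProfile(u)`, with `w = u` and `k = cubicProfile(u)`. -/
theorem IsSolutionP.exists_energy_estimate [IsFiniteMeasure (volume.restrict Ω)]
    {a : EuclideanSpace ℝ (Fin N) → ℝ} {γ p lam : ℝ}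
    {u : EuclideanSpace ℝ (Fin N) → ℝ} (hu : IsSolutionP Ω a γ p lam u)
    {φ : EuclideanSpace ℝ (Fin N) → ℝ} (hφ : IsTestFunction Ω φ) :
    ∃ w k : EuclideanSpace ℝ (Fin N) → ℝ,
      (∀ᵐ x ∂(volume.restrict Ω), 0 < w x ∧ (9 * (1 + w x ^ 3))⁻¹ ≤ k x) ∧
      IntegrableOn (fun x => (a x * w x ^ (-γ) + lam * w x ^ p) * k x * φ x ^ 2) Ω ∧
      ∫ x in Ω, (a x * w x ^ (-γ) + lam * w x ^ p) * k x * φ x ^ 2 ≤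
        2 * ∫ x in Ω, ‖gradient φ x‖ ^ 2 := by
  obtain ⟨hbdd, hpos, Du, hDu, hweak⟩ := hu
  have hψ := hDu.testFunction_mul_comp hφ.sq contDiff_cubicProfile abs_deriv_cubicProfile_le
  obtain ⟨hi0, hi1, hi2, heq⟩ := hweak _ _ hψ
  have hsum : ∀ x, a x * u x ^ (-γ) * (φ x ^ 2 * cubicProfile (u x)) +
      lam * (u x ^ p * (φ x ^ 2 * cubicProfile (u x))) =
      (a x * u x ^ (-γ) + lam * u x ^ p) * cubicProfile (u x) * φ x ^ 2 :=
    fun x => by ring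
  refine ⟨u, fun x => cubicProfile (u x), ?_, ?_, ?_⟩
  · filter_upwards [hpos] with x hx
    exact ⟨hx, inv_le_cubicProfile hx.le⟩
  · exact (hi1.add (hi2.const_mul lam)).congr (Eventually.of_forall hsum)
  · simp only [← hsum]
    rw [integral_add hi1 (hi2.const_mul lam), integral_const_mul, ← heq,
      ← integral_const_mul]
    refine integral_mono_ae (Integrable.add ?_ hi0)
      (hφ.integrableOn_norm_gradient_sq.const_mul 2) ?_
    -- Boundedness of `u` makes the weight `1 + 2u²` harmless for integrability; the bound `C` does
    -- not enter the estimate.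
    · obtain ⟨C, hC⟩ := exists_bound_of_memLp_top hbdd
      refine Integrable.bdd_mul (c := 1 + 2 * C ^ 2)
        (integrable_inner_of_memLp_two hDu.memLp_gradient hψ.memLp_gradient) ?_ ?_
      · exact aestronglyMeasurable_const.add ((hbdd.1.pow 2).const_mul 2)
      · filter_upwards [hC] with x hx
        rw [Real.norm_of_nonneg (by positivity), ← sq_abs, ← Real.norm_eq_abs]
        gcongr
    · filter_upwards [hpos] with x hx
      have h1 := cubicProfile_sq_le hx.le
      -- With `X = φ (1 + 2u²) cubicProfile(u) ∇u`, the integrand is at most `2 X·∇φ - |X|²/2 =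
      -- 2|∇φ|² - |X - 2∇φ|²/2`.
      have h2 := norm_sub_sq_real
        ((φ x * ((1 + 2 * u x ^ 2) * cubicProfile (u x))) • Du x) ((2 : ℝ) • gradient φ x)
      rw [real_inner_smul_left, inner_smul_right, norm_smul, norm_smul, mul_pow, mul_pow,
        Real.norm_eq_abs, sq_abs, Real.norm_eq_abs, sq_abs] at h2
      rw [gradient_sq (hφ.contDiff.differentiable (by simp) x), inner_add_right,
        inner_smul_right, inner_smul_right, inner_smul_right, real_inner_self_eq_norm_sq]
      have h3 := mul_le_mul_of_nonneg_right h1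
        (by positivity : 0 ≤ φ x ^ 2 * ‖Du x‖ ^ 2)
      have h4 := sq_nonneg ‖(φ x * ((1 + 2 * u x ^ 2) * cubicProfile (u x))) • Du x -
        (2 : ℝ) • gradient φ x‖
      linear_combination h3 + (1 / 2) * h4 + (1 / 2) * h2

end Energy

/-- A bump function on a ball inside `Ω` works. Truncating `a` at `1` keeps the integral finite,
since `a` is merely measurable. -/
theorem IsBoundedSmoothDomain.exists_testFunction_integral_pos {N : ℕ}
    {Ω : Set (EuclideanSpace ℝ (Fin N))} (hΩ : IsBoundedSmoothDomain Ω)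
    {a : EuclideanSpace ℝ (Fin N) → ℝ} (ha : AEMeasurable a (volume.restrict Ω))
    (ha_pos : ∀ᵐ x ∂(volume.restrict Ω), 0 < a x) :
    ∃ φ, IsTestFunction Ω φ ∧ 0 < ∫ x in Ω, min (a x) 1 * φ x ^ 2 := by
  obtain ⟨c, hc⟩ := hΩ.isConnected.nonempty
  obtain ⟨ε, hε, hball⟩ := Metric.nhds_basis_closedBall.mem_iff.1 (hΩ.isOpen.mem_nhds hc)
  let φ : ContDiffBump c := ⟨ε / 2, ε, by positivity, by linarith⟩
  have hφ : IsTestFunction Ω φ :=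
    ⟨φ.contDiff, φ.hasCompactSupport, by rw [φ.tsupport_eq]; exact hball⟩
  refine ⟨φ, hφ, ?_⟩
  rw [integral_pos_iff_support_of_nonneg_ae ?_ (hφ.integrableOn_min_mul_sq ha ha_pos)]
  · have hsub : Metric.ball c ε ⊆ Ω := Metric.ball_subset_closedBall.trans hball
    have h0 : 0 < volume.restrict Ω (Metric.ball c ε) := by
      rw [Measure.restrict_apply Metric.isOpen_ball.measurableSet,
        inter_eq_self_of_subset_left hsub]
      exact Metric.measure_ball_pos volume c hε
    refine h0.trans_le (measure_mono_ae ?_)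
    filter_upwards [ha_pos] with x hx hxb
    have h1 : φ x ≠ 0 := (φ.pos_of_mem_ball hxb).ne'
    exact mul_ne_zero (lt_min hx one_pos).ne' (pow_ne_zero 2 h1)
  · filter_upwards [ha_pos] with x hx
    exact mul_nonneg (lt_min hx one_pos).le (sq_nonneg _)

end QuasilinearSingular

open QuasilinearSingular in
theorem lemma2p2 {N : ℕ} (hN : 3 ≤ N) (Ω : Set (EuclideanSpace ℝ (Fin N)))
    (hΩ : QuasilinearSingular.IsBoundedSmoothDomain Ω)
    (a : EuclideanSpace ℝ (Fin N) → ℝ)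
    (ha : AEMeasurable a (volume.restrict Ω))
    (ha_pos : ∀ᵐ x ∂(volume.restrict Ω), 0 < a x)
    (γ p : ℝ) (hγ : 0 < γ) (hp : 3 ≤ p) :
    ∃ lamStar : ℝ, 0 < lamStar ∧ ∀ lam : ℝ, lamStar < lam →
      (¬ ∃ v : EuclideanSpace ℝ (Fin N) → ℝ,
          QuasilinearSingular.IsSolutionQ Ω a γ p lam v) ∧
      (¬ ∃ u : EuclideanSpace ℝ (Fin N) → ℝ,
          QuasilinearSingular.IsSolutionP Ω a γ p lam u) := by
  have : IsFiniteMeasure (volume.restrict Ω) :=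
    isFiniteMeasure_restrict.2 hΩ.isBounded.measure_lt_top.ne
  obtain ⟨φ, hφ, hI⟩ := hΩ.exists_testFunction_integral_pos ha ha_pos
  set I : ℝ := ∫ x in Ω, min (a x) 1 * φ x ^ 2 with hI_def
  set D : ℝ := ∫ x in Ω, ‖gradient φ x‖ ^ 2
  have hD : 0 ≤ D := integral_nonneg fun x => by positivity
  -- `M` is the size required of `δ ^ (-γ)`: the lower bound `M / 18 * I` must exceed `2 * D`. The
  -- summand `1` makes this strict and gives `M ≥ 1`, hence `δ ≤ 1`.
  set M : ℝ := 36 * D / I + 1 with hM_def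
  have hM1 : 1 ≤ M := by
    have : 0 ≤ 36 * D / I := by positivity
    linarith
  have hM0 : 0 < M := one_pos.trans_le hM1
  set δ : ℝ := M ^ (-γ⁻¹)
  have hδ : 0 < δ := by positivity
  have hδ1 : δ ≤ 1 := Real.rpow_le_one_of_one_le_of_nonpos hM1 (by simp [hγ.le])
  have hδM : δ ^ (-γ) = M := by
    rw [← Real.rpow_mul hM0.le, neg_mul_neg, inv_mul_cancel₀ hγ.ne', Real.rpow_one]
  have hlarge : 2 * D < M / 18 * I := by
    have : M * I = 36 * D + I := by
      rw [hM_def, add_mul, div_mul_cancel₀ _ hI.ne', one_mul]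
    linarith
  have contra : ∀ lam : ℝ, δ ^ (-γ - p) < lam → ∀ w k : EuclideanSpace ℝ (Fin N) → ℝ,
      (∀ᵐ x ∂(volume.restrict Ω), 0 < w x ∧ (9 * (1 + w x ^ 3))⁻¹ ≤ k x) →
      IntegrableOn (fun x => (a x * w x ^ (-γ) + lam * w x ^ p) * k x * φ x ^ 2) Ω →
      ¬ ∫ x in Ω, (a x * w x ^ (-γ) + lam * w x ^ p) * k x * φ x ^ 2 ≤ 2 * D := by
    intro lam hlam w k hwk hint hle
    refine (hlarge.trans_le (le_trans ?_ hle)).false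
    rw [hI_def, ← integral_const_mul]
    refine integral_mono_ae ((hφ.integrableOn_min_mul_sq ha ha_pos).const_mul _) hint ?_
    filter_upwards [ha_pos, hwk] with x hax hx
    have h := min_mul_le_singular_add_power hax hx.1 hγ hp hδ hδ1 hlam.le hx.2
    rw [hδM] at h
    calc M / 18 * (min (a x) 1 * φ x ^ 2) = min (a x) 1 * (M / 18) * φ x ^ 2 := by ring
      _ ≤ _ := by gcongr
  refine ⟨δ ^ (-γ - p), by positivity, fun lam hlam => ⟨?_, ?_⟩⟩
  · rintro ⟨v, hv⟩
    obtain ⟨w, k, hwk, hint, hle⟩ := hv.exists_energy_estimate hφ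
    exact contra lam hlam w k hwk hint hle
  · rintro ⟨u, hu⟩
    obtain ⟨w, k, hwk, hint, hle⟩ := hu.exists_energy_estimate hφ
    exact contra lam hlam w k hwk hint hle
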